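/- Let $B_j$ denote the Bernoulli numbers, let $\delta_{km}$ be the Kronecker delta, and for integers $k\ge 0$, $n\ge 1$ put \[ p(n,k)=\frac{n^k\log n}{2}+\frac{n^{k+1}}{k+1}\left(\log n-\frac{1}{k+1}\right)+k!\sum_{m=1}^{k}\frac{n^{k-m}B_{m+1}}{(m+1)!\,(k-m)!}\left(\log n+(1-\delta_{km})\sum_{l=1}^{m}\frac{1}{k-l+1}\right). \] The generalized Glaisher (Bendersky--Adamchik) constants $D_k>0$ are defined by \[ \log D_k=\lim_{n\to\infty}\left(\sum_{m=1}^{n}m^k\log m-p(n,k)\right). \] For $\alpha>0$ let $I_{1^-}^{\alpha}f(x)=\frac{1}{\Gamma(\alpha)}\int_x^1(t-x)^{\alpha-1}f(t)\,dt$ be the right-sided Riemann--Liouville fractional integral. Then for every integer $m\ge 1$ the limits defining $D_0,\dots,D_{m-1}$ exist, all the integrals below converge absolutely, and \[ I_{1^-}^m\log\Gamma(0)=\int_{0}^{1}dt_1\int_{t_1}^{1}dt_2\cdots\int_{t_{m-1}}^{1}dt_m\,\log\Gamma(t_m) =\frac{1}{m!}\left(-\sum_{k=0}^{m-1}\binom{m}{k}\log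 D_k+\log\pi-\int_{0}^{1}m\,t^{m-1}\log\sin(\pi t)\,dt\right). \] -/

import Mathlib

open Filter Topology MeasureTheory

noncomputable section

/-- The comparison term `p(n, k)` in the definition of the generalized Glaisher
(Bendersky-Adamchik) constants:
`n^k log n / 2 + n^(k+1)/(k+1) (log n - 1/(k+1))
  + k! ∑_{m=1}^k n^(k-m) B_{m+1} / ((m+1)! (k-m)!)
      (log n + (1 - δ_{km}) ∑_{l=1}^m 1/(k-l+1))`. -/
def glaisherP (n k : ℕ) : ℝ :=
  (n : ℝ) ^ k * Real.log n / 2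
    + (n : ℝ) ^ (k + 1) / ((k : ℝ) + 1) * (Real.log n - 1 / ((k : ℝ) + 1))
    + (k.factorial : ℝ) * ∑ m ∈ Finset.Icc 1 k,
        (n : ℝ) ^ (k - m) * (bernoulli (m + 1) : ℝ)
            / (((m + 1).factorial : ℝ) * ((k - m).factorial : ℝ))
          * (Real.log n
              + (1 - if k = m then (1 : ℝ) else 0)
                * ∑ l ∈ Finset.Icc 1 m, 1 / ((k : ℝ) - (l : ℝ) + 1))

/-- The sequence `∑_{m=1}^n m^k log m - p(n, k)` whose limit is `log D_k`. -/
def glaisherSeq (k n : ℕ) : ℝ :=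
  (∑ m ∈ Finset.Icc 1 n, (m : ℝ) ^ k * Real.log m) - glaisherP n k

/-- The generalized Glaisher (Bendersky-Adamchik) constant `D_k`, the positive real number with
`log D_k = lim_{n → ∞} (∑_{m=1}^n m^k log m - p(n, k))`. -/
def glaisherD (k : ℕ) : ℝ :=
  Real.exp (limUnder atTop (glaisherSeq k))

/-- The right-sided Riemann-Liouville fractional integral of order `α > 0`:
`(I_{b^-}^α f)(x) = 1/Γ(α) ∫_x^b (t - x)^(α - 1) f(t) dt`, for `x < b`. -/
def rightRiemannLiouville (b α : ℝ) (f : ℝ → ℝ) (x : ℝ) : ℝ :=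
  1 / Real.Gamma α * ∫ t in x..b, (t - x) ^ (α - 1) * f t

/-- The repeated right integral
`∫_x^b dt_1 ∫_{t_1}^b dt_2 … ∫_{t_{m-1}}^b dt_m f(t_m)`, with `m` integral signs. -/
def rightRepeatedIntegral (b : ℝ) (f : ℝ → ℝ) : ℕ → ℝ → ℝ
  | 0 => f
  | m + 1 => fun x => ∫ t in x..b, rightRepeatedIntegral b f m t

/-- The function `log Γ` (used on `(0, 1]`, where `Γ` is positive). -/
def logGamma (t : ℝ) : ℝ := Real.log (Real.Gamma t)

end

/-! Write `m = p + 1`. Cauchy's formula (`rightRepeatedIntegral_succ_eq_integral`) collapses the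
repeated integral to `1/p! ∫ t^p log Γ(t)`. By the reflection formula and `t ↦ 1 - t`
(`integral_pow_mul_log_sin`), it remains to evaluate `W(0)`, where `W(n) = ∫ (p+1)(1-t)^p log
Γ(n+t)`, as `∑ binom(p+1,k) log D_k`.

The functional equation of `Γ` writes `W(0)` as `W(n)` minus integrals of `log (j+t)`, `j < n`,
which have closed forms and telescope to a binomial combination of the sums `∑ j^k log j` plus
elementary terms (`sum_integral_pow_mul_log`). Log-convexity gives `W(n) = log Γ(n) + log n/(p+2) +
o(1)`.

Replacing each `∑ j^k log j` by `glaisherSeq` plus `p(n,k)` leaves elementary terms `Q(n) log n +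
R(n)` with `R(0) = 0`. Their cancellation need not be computed: the expression converges, which
forces its limit to be `0` (`IsLogPoly.eq_zero_of_tendsto`). Convergence of `glaisherSeq` itself
comes from Euler-Maclaurin with increments `O(n⁻²)`. -/

/-! ### Existence of the generalized Glaisher constants -/

/-- The Bernoulli polynomial over `ℝ`, divided by the factorial of its index. -/
noncomputable def bernoulliScaled (i : ℕ) (t : ℝ) : ℝ :=
  ((Polynomial.bernoulli i).map (algebraMap ℚ ℝ)).eval t / (i.factorial : ℝ)

lemma hasDerivAt_bernoulliScaled_zero (t : ℝ) : HasDerivAt (bernoulliScaled 0) 0 t := by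
  have : bernoulliScaled 0 = fun _ => (1 : ℝ) := by
    funext t; simp [bernoulliScaled]
  rw [this]
  exact hasDerivAt_const t 1

lemma hasDerivAt_bernoulliScaled_succ (i : ℕ) (t : ℝ) :
    HasDerivAt (bernoulliScaled (i + 1)) (bernoulliScaled i t) t := by
  have h := (((Polynomial.bernoulli (i + 1)).map (algebraMap ℚ ℝ)).hasDerivAt t).div_const
    ((i + 1).factorial : ℝ)
  refine h.congr_deriv ?_
  rw [Polynomial.derivative_map, Polynomial.derivative_bernoulli_add_one]
  have h1 : ((i.factorial : ℕ) : ℝ) ≠ 0 := by positivity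
  have h2 : ((i : ℝ) + 1) ≠ 0 := by positivity
  simp only [bernoulliScaled, Nat.factorial_succ, Polynomial.map_mul, Polynomial.eval_mul]
  push_cast
  simp
  field_simp

lemma bernoulliScaled_one (i : ℕ) :
    bernoulliScaled i 1 = (bernoulli' i : ℝ) / (i.factorial : ℝ) := by
  have := Polynomial.bernoulli_eval_one i
  rw [bernoulliScaled, Polynomial.eval_one_map, this]
  simp

lemma bernoulliScaled_zero (i : ℕ) :
    bernoulliScaled i 0 = (bernoulli i : ℝ) / (i.factorial : ℝ) := by
  have := Polynomial.bernoulli_eval_zero i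
  rw [bernoulliScaled, Polynomial.eval_zero_map, this]
  simp

lemma continuous_bernoulliScaled (i : ℕ) : Continuous (bernoulliScaled i) :=
  (Polynomial.continuous _).div_const _

/-- The derivative of a Taylor-type sum with Bernoulli polynomial weights telescopes. -/
lemma hasDerivAt_sum_bernoulliScaled (G : ℕ → ℝ → ℝ) (c t : ℝ) (r : ℕ)
    (hG : ∀ i ≤ r, HasDerivAt (G i) (G (i + 1) (c - t)) (c - t)) :
    HasDerivAt (fun s => ∑ i ∈ Finset.range (r + 1), bernoulliScaled i s * G i (c - s))
      (-(bernoulliScaled r t * G (r + 1) (c - t))) t := by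
  have hsub : HasDerivAt (fun s : ℝ => c - s) (-1) t := (hasDerivAt_id t).const_sub c
  induction r with
  | zero =>
    have h := (hasDerivAt_bernoulliScaled_zero t).mul ((hG 0 le_rfl).comp t hsub)
    simp only [zero_add, Finset.sum_range_one]
    refine h.congr_deriv ?_
    simp
  | succ r ih =>
    have h := (ih fun i hi => hG i (by omega)).add
      ((hasDerivAt_bernoulliScaled_succ r t).mul ((hG (r + 1) le_rfl).comp t hsub))
    simp only [Finset.sum_range_succ _ (r + 1)]
    refine h.congr_deriv ?_
    simp

/-- One step of the Euler-Maclaurin formula, with an explicit bound for the remainder. -/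
lemma exists_eulerMaclaurin_step_bound (r : ℕ) (hr : 1 ≤ r) :
    ∃ K : ℝ, ∀ (G : ℕ → ℝ → ℝ) (a C : ℝ),
      (∀ i ≤ r, ∀ x ∈ Set.Icc a (a + 1), HasDerivAt (G i) (G (i + 1) x) x) →
      (∀ x ∈ Set.Icc a (a + 1), |G (r + 1) x| ≤ C) →
      |∑ i ∈ Finset.range (r + 1),
          (bernoulli' i : ℝ) / (i.factorial : ℝ) * (G i a - G i (a + 1)) + G 1 (a + 1)|
        ≤ K * C := by
  obtain ⟨K, hK⟩ := isCompact_Icc.exists_bound_of_continuousOn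
    (continuous_bernoulliScaled r).continuousOn (s := Set.Icc (0 : ℝ) 1)
  refine ⟨K, fun G a C hG hC => ?_⟩
  have hmem : ∀ t ∈ Set.Icc (0 : ℝ) 1, a + 1 - t ∈ Set.Icc a (a + 1) := fun t ht =>
    ⟨by linarith [ht.2], by linarith [ht.1]⟩
  -- The mean value inequality on `[0, 1]` takes the place of an integral remainder, since the
  -- derivative is a single term.
  have hmvt := norm_image_sub_le_of_norm_deriv_le_segment_01'
    (f := fun s => ∑ i ∈ Finset.range (r + 1), bernoulliScaled i s * G i (a + 1 - s))
    (f' := fun t => -(bernoulliScaled r t * G (r + 1) (a + 1 - t))) (C := K * C)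
    (fun t ht => (hasDerivAt_sum_bernoulliScaled G (a + 1) t r
      fun i hi => hG i hi _ (hmem t ht)).hasDerivWithinAt)
    (fun t ht => by
      have ht' : t ∈ Set.Icc (0 : ℝ) 1 := ⟨ht.1, ht.2.le⟩
      have h1 := hK t ht'
      rw [norm_neg, norm_mul]
      exact mul_le_mul h1 (hC _ (hmem t ht')) (norm_nonneg _) ((norm_nonneg _).trans h1))
  rw [Real.norm_eq_abs] at hmvt
  refine le_of_eq_of_le ?_ hmvt
  congr 1
  simp only [bernoulliScaled_one, bernoulliScaled_zero, ← Finset.sum_sub_distrib]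
  -- `B_i(1) = B_i(0)` except for `i = 1`, where `1/2` against `-1/2` produces the extra `G 1 (a +
  -- 1)`.
  have hsub : ∀ i ∈ Finset.range (r + 1),
      (bernoulli' i : ℝ) / (i.factorial : ℝ) * G i (a + 1 - 1)
        - (bernoulli i : ℝ) / (i.factorial : ℝ) * G i (a + 1 - 0)
      = (bernoulli' i : ℝ) / (i.factorial : ℝ) * (G i a - G i (a + 1))
        + if i = 1 then G 1 (a + 1) else 0 := by
    intro i _
    rw [add_sub_cancel_right, sub_zero]
    split_ifs with h
    · subst h
      norm_num [bernoulli'_one, bernoulli_one]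
      ring
    · rw [bernoulli_eq_bernoulli'_of_ne_one h]
      ring
  rw [Finset.sum_congr rfl hsub, Finset.sum_add_distrib, Finset.sum_ite_eq' _ 1]
  simp [Nat.pos_of_ne_zero (by omega : r ≠ 0)]

/-- An antiderivative of `x ^ k * log x` (index `0`) and its successive derivatives, up to
index `k + 3`. -/
noncomputable def powLogDeriv (k : ℕ) : ℕ → ℝ → ℝ
  | 0 => fun x => x ^ (k + 1) / ((k : ℝ) + 1) * (Real.log x - 1 / ((k : ℝ) + 1))
  | i + 1 => fun x =>
    if i ≤ k then
      (k.factorial : ℝ) / ((k - i).factorial : ℝ) * x ^ (k - i)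
        * (Real.log x + ∑ l ∈ Finset.Icc 1 i, 1 / ((k : ℝ) - (l : ℝ) + 1))
    else if i = k + 1 then (k.factorial : ℝ) / x
    else -((k.factorial : ℝ) / x ^ 2)

lemma hasDerivAt_powLogDeriv (k i : ℕ) (hi : i ≤ k + 2) {x : ℝ} (hx : 0 < x) :
    HasDerivAt (powLogDeriv k i) (powLogDeriv k (i + 1) x) x := by
  have hlog := Real.hasDerivAt_log hx.ne'
  have hx' := hx.ne'
  rcases i with _ | i
  · have h := ((hasDerivAt_pow (k + 1) x).div_const ((k : ℝ) + 1)).mul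
      (hlog.sub_const (1 / ((k : ℝ) + 1)))
    refine h.congr_deriv ?_
    have hk : (k : ℝ) + 1 ≠ 0 := by positivity
    have hf : (k.factorial : ℝ) ≠ 0 := by positivity
    simp [powLogDeriv, hf]
    field_simp
    ring
  · rcases lt_trichotomy i k with h | h | h
    · obtain ⟨j, rfl⟩ : ∃ j, k = i + 1 + j := ⟨k - (i + 1), by omega⟩
      have h1 : i + 1 + j - i = j + 1 := by omega
      have h2 : i + 1 + j - (i + 1) = j := by omega
      have hd := ((hasDerivAt_pow (j + 1) x).const_mul
        (((i + 1 + j).factorial : ℝ) / ((j + 1).factorial : ℝ))).mul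
        (hlog.add_const (∑ l ∈ Finset.Icc 1 i, 1 / (((i + 1 + j : ℕ) : ℝ) - (l : ℝ) + 1)))
      have e1 : powLogDeriv (i + 1 + j) (i + 1) = fun x =>
          ((i + 1 + j).factorial : ℝ) / ((j + 1).factorial : ℝ) * x ^ (j + 1)
        * (Real.log x + ∑ l ∈ Finset.Icc 1 i, 1 / (((i + 1 + j : ℕ) : ℝ) - (l : ℝ) + 1)) := by
        funext y
        simp only [powLogDeriv, h1]
        rw [if_pos (by omega)]
      rw [e1]
      refine hd.congr_deriv ?_
      simp only [powLogDeriv, h2]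
      rw [if_pos (by omega), Finset.sum_Icc_succ_top (by omega), Nat.factorial_succ j]
      have hj : (j : ℝ) + 1 ≠ 0 := by positivity
      have hf : (j.factorial : ℝ) ≠ 0 := by positivity
      have e2 : (((i + 1 + j : ℕ) : ℝ) - ((i + 1 : ℕ) : ℝ) + 1) = j + 1 := by push_cast; ring
      rw [e2]
      generalize ∑ l ∈ Finset.Icc 1 i, 1 / (((i + 1 + j : ℕ) : ℝ) - (l : ℝ) + 1) = S
      push_cast
      field_simp
      ring
    · subst h
      have e1 : powLogDeriv i (i + 1) = fun x => (i.factorial : ℝ)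
          * (Real.log x + ∑ l ∈ Finset.Icc 1 i, 1 / ((i : ℝ) - (l : ℝ) + 1)) := by
        funext y
        simp [powLogDeriv]
      rw [e1]
      refine ((hlog.add_const _).const_mul _).congr_deriv ?_
      simp [powLogDeriv, div_eq_mul_inv]
    · obtain rfl : i = k + 1 := by omega
      have e1 : powLogDeriv k (k + 1 + 1) = fun x => (k.factorial : ℝ) * x⁻¹ := by
        funext y
        simp [powLogDeriv, div_eq_mul_inv]
      rw [e1]
      refine ((hasDerivAt_inv hx').const_mul _).congr_deriv ?_
      simp [powLogDeriv, div_eq_mul_inv]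

/-- The Euler-Maclaurin boundary terms are `p(n, k)` except in two places: the Kronecker delta
deletes a constant at `m = k`, which becomes `c`, and the last term `i = k + 2` is a multiple of
`1/n`. The convention `B_1 = +1/2` gives `n^k log n / 2` its sign. -/
lemma exists_sum_powLogDeriv_eq_glaisherP (k : ℕ) :
    ∃ c b : ℝ, ∀ n : ℕ,
      ∑ i ∈ Finset.range (k + 3),
        (bernoulli' i : ℝ) / (i.factorial : ℝ) * powLogDeriv k i n
      = glaisherP n k + c + b * (n : ℝ)⁻¹ := by
  refine ⟨∑ m ∈ Finset.Icc 1 k, if k = m then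
      (k.factorial : ℝ) * (bernoulli (m + 1) : ℝ) / ((m + 1).factorial : ℝ)
        * ∑ l ∈ Finset.Icc 1 m, 1 / ((k : ℝ) - (l : ℝ) + 1) else 0,
    (bernoulli' (k + 2) : ℝ) / ((k + 2).factorial : ℝ) * (k.factorial : ℝ), fun n => ?_⟩
  have hf : (k.factorial : ℝ) ≠ 0 := by positivity
  have hIcc : ∀ F : ℕ → ℝ, ∑ m ∈ Finset.Icc 1 k, F m = ∑ j ∈ Finset.range k, F (j + 1) := by
    intro F
    rw [Finset.range_eq_Ico, Finset.sum_Ico_add' F 0 k 1]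
    rfl
  rw [Finset.sum_range_succ, Finset.sum_range_succ', Finset.sum_range_succ', glaisherP,
    Finset.mul_sum, hIcc, hIcc]
  have hlast : powLogDeriv k (k + 2) n = (k.factorial : ℝ) * (n : ℝ)⁻¹ := by
    simp [powLogDeriv, div_eq_mul_inv]
  have h1 : powLogDeriv k (0 + 1) n = (n : ℝ) ^ k * Real.log n := by
    simp [powLogDeriv, hf]
  have h0 : powLogDeriv k 0 n
      = (n : ℝ) ^ (k + 1) / ((k : ℝ) + 1) * (Real.log n - 1 / ((k : ℝ) + 1)) := rfl
  have hmid : ∀ j ∈ Finset.range k,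
      (bernoulli' (j + 1 + 1) : ℝ) / ((j + 1 + 1).factorial : ℝ)
        * powLogDeriv k (j + 1 + 1) n
      = (k.factorial : ℝ) * ((n : ℝ) ^ (k - (j + 1)) * (bernoulli (j + 1 + 1) : ℝ)
            / (((j + 1 + 1).factorial : ℝ) * ((k - (j + 1)).factorial : ℝ))
          * (Real.log n
              + (1 - if k = j + 1 then (1 : ℝ) else 0)
                * ∑ l ∈ Finset.Icc 1 (j + 1), 1 / ((k : ℝ) - (l : ℝ) + 1)))
        + if k = j + 1 then
      (k.factorial : ℝ) * (bernoulli (j + 1 + 1) : ℝ) / ((j + 1 + 1).factorial : ℝ)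
        * ∑ l ∈ Finset.Icc 1 (j + 1), 1 / ((k : ℝ) - (l : ℝ) + 1) else 0 := by
    intro j hj
    have hj' := Finset.mem_range.1 hj
    rw [bernoulli_eq_bernoulli'_of_ne_one (by omega)]
    simp only [powLogDeriv]
    rw [if_pos (by omega : j + 1 ≤ k)]
    have f1 : ((j + 1 + 1).factorial : ℝ) ≠ 0 := by positivity
    have f2 : ((k - (j + 1)).factorial : ℝ) ≠ 0 := by positivity
    split_ifs with h
    · have h0 : k - (j + 1) = 0 := by omega
      rw [h0]
      simp
      field_simp
    · field_simp
      ring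
  rw [Finset.sum_congr rfl hmid, Finset.sum_add_distrib, hlast, h1, h0]
  simp
  ring

lemma exists_tendsto_glaisherSeq (k : ℕ) : ∃ L, Tendsto (glaisherSeq k) atTop (𝓝 L) := by
  -- At order `k + 2` the remainder involves derivative `k + 3`, namely `-k!/x²`, which is summable;
  -- one order lower it would be `k!/x`.
  obtain ⟨K, hK⟩ := exists_eulerMaclaurin_step_bound (k + 2) (by omega)
  obtain ⟨c, b, hP⟩ := exists_sum_powLogDeriv_eq_glaisherP k
  set P : ℕ → ℝ := fun n => ∑ i ∈ Finset.range (k + 3),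
        (bernoulli' i : ℝ) / (i.factorial : ℝ) * powLogDeriv k i n with hPdef
  set S : ℕ → ℝ := fun n => ∑ m ∈ Finset.Icc 1 n, (m : ℝ) ^ k * Real.log m with hSdef
  -- The index starts at `1` to stay away from the singularity of the logarithm.
  have hstep : ∀ n : ℕ, dist (S (n + 1) - P (n + 1)) (S (n + 1 + 1) - P (n + 1 + 1))
      ≤ K * (k.factorial : ℝ) * (1 / ((n + 1 : ℕ) : ℝ) ^ 2) := by
    intro n
    have hpos : (0 : ℝ) < ((n + 1 : ℕ) : ℝ) := by positivity
    have h := hK (powLogDeriv k) ((n + 1 : ℕ) : ℝ)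
      ((k.factorial : ℝ) * (1 / ((n + 1 : ℕ) : ℝ) ^ 2))
      (fun i hi x hx => hasDerivAt_powLogDeriv k i hi (hpos.trans_le hx.1))
      (fun x hx => by
        have hx0 := hpos.trans_le hx.1
        have e : powLogDeriv k (k + 2 + 1) x = -((k.factorial : ℝ) / x ^ 2) := by
          simp [powLogDeriv]
        rw [e, abs_neg, abs_of_nonneg (by positivity), mul_one_div]
        have := hx.1
        gcongr)
    rw [mul_assoc]
    refine le_of_eq_of_le ?_ h
    rw [Real.dist_eq, abs_sub_comm]
    congr 1
    have e1 : powLogDeriv k 1 (((n + 1 : ℕ) : ℝ) + 1)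
        = ((n + 1 + 1 : ℕ) : ℝ) ^ k * Real.log ((n + 1 + 1 : ℕ) : ℝ) := by
      have hf : (k.factorial : ℝ) ≠ 0 := by positivity
      simp [powLogDeriv, hf]
    rw [e1]
    simp only [hSdef, hPdef]
    rw [Finset.sum_Icc_succ_top (by omega)]
    simp only [mul_sub, Finset.sum_sub_distrib]
    push_cast
    ring
  have hsum : Summable fun n : ℕ =>
      K * (k.factorial : ℝ) * (1 / ((n + 1 : ℕ) : ℝ) ^ 2) :=
    ((summable_nat_add_iff 1).2 (Real.summable_one_div_nat_pow.2 one_lt_two)).mul_left _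
  obtain ⟨L, hL⟩ := cauchySeq_tendsto_of_complete
    (cauchySeq_of_dist_le_of_summable _ hstep hsum)
  have hL' : Tendsto (fun n => S n - P n) atTop (𝓝 L) :=
    (tendsto_add_atTop_iff_nat (f := fun n => S n - P n) 1).1 hL
  refine ⟨L + c + b * 0, ?_⟩
  refine ((hL'.add_const c).add (tendsto_inv_atTop_nhds_zero_nat.const_mul b)).congr fun n => ?_
  simp only [hPdef, hP, glaisherSeq, hSdef]
  ring

lemma tendsto_glaisherSeq (k : ℕ) :
    Tendsto (glaisherSeq k) atTop (𝓝 (Real.log (glaisherD k))) := by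
  obtain ⟨L, hL⟩ := exists_tendsto_glaisherSeq k
  rwa [glaisherD, Real.log_exp, hL.limUnder_eq]

/-! ### Sequences of the form `Q(n) log n + R(n)` -/

/-- Sequences `Q(n) log n + R(n)` with polynomials `Q` and `R` such that `R(0) = 0`. -/
def IsLogPoly (u : ℕ → ℝ) : Prop :=
  ∃ Q R : Polynomial ℝ, R.eval 0 = 0 ∧
    ∀ n : ℕ, 1 ≤ n → u n = Q.eval (n : ℝ) * Real.log n + R.eval (n : ℝ)

namespace IsLogPoly

lemma add {u v : ℕ → ℝ} (hu : IsLogPoly u) (hv : IsLogPoly v) :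
    IsLogPoly fun n => u n + v n := by
  obtain ⟨Q, R, h0, h⟩ := hu
  obtain ⟨Q', R', h0', h'⟩ := hv
  refine ⟨Q + Q', R + R', by simp [h0, h0'], fun n hn => ?_⟩
  simp only [h n hn, h' n hn, Polynomial.eval_add]
  ring

lemma const_mul {u : ℕ → ℝ} (c : ℝ) (hu : IsLogPoly u) : IsLogPoly fun n => c * u n := by
  obtain ⟨Q, R, h0, h⟩ := hu
  refine ⟨Polynomial.C c * Q, Polynomial.C c * R, by simp [h0], fun n hn => ?_⟩
  simp only [h n hn, Polynomial.eval_mul, Polynomial.eval_C]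
  ring

lemma sub {u v : ℕ → ℝ} (hu : IsLogPoly u) (hv : IsLogPoly v) :
    IsLogPoly fun n => u n - v n := by
  simpa [sub_eq_add_neg] using hu.add (hv.const_mul (-1))

lemma congr {u v : ℕ → ℝ} (hu : IsLogPoly u) (h : ∀ n, 1 ≤ n → v n = u n) : IsLogPoly v := by
  obtain ⟨Q, R, h0, hQ⟩ := hu
  exact ⟨Q, R, h0, fun n hn => (h n hn).trans (hQ n hn)⟩

lemma zero : IsLogPoly fun _ => 0 := ⟨0, 0, by simp, by simp⟩

lemma sum {ι : Type*} (s : Finset ι) {u : ι → ℕ → ℝ} (h : ∀ i ∈ s, IsLogPoly (u i)) :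
    IsLogPoly fun n => ∑ i ∈ s, u i n := by
  classical
  induction s using Finset.induction_on with
  | empty => simpa using zero
  | insert a s ha ih =>
    simp only [Finset.sum_insert ha]
    exact (h a (Finset.mem_insert_self a s)).add
      (ih fun i hi => h i (Finset.mem_insert_of_mem hi))

lemma pow_mul_log (k : ℕ) : IsLogPoly fun n => (n : ℝ) ^ k * Real.log n :=
  ⟨Polynomial.X ^ k, 0, by simp, by simp⟩

lemma pow_succ (k : ℕ) : IsLogPoly fun n => (n : ℝ) ^ (k + 1) :=
  ⟨0, Polynomial.X ^ (k + 1), by simp, by simp⟩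

/-- Faulhaber's formula has only positive powers of `n`, hence no constant term. -/
lemma sum_range_pow (k : ℕ) : IsLogPoly fun n => ∑ j ∈ Finset.range n, (j : ℝ) ^ k := by
  have h : ∀ n : ℕ, ∑ j ∈ Finset.range n, (j : ℝ) ^ k
      = ∑ i ∈ Finset.range (k + 1),
        ((bernoulli i : ℝ) * ((k + 1).choose i : ℝ) / ((k : ℝ) + 1)) * (n : ℝ) ^ (k + 1 - i) := by
    intro n
    have := congrArg (Rat.cast : ℚ → ℝ) (_root_.sum_range_pow n k)
    push_cast at this
    rw [this]
    exact Finset.sum_congr rfl fun i _ => by ring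
  simp only [h]
  refine sum _ fun i hi => const_mul _ ?_
  obtain ⟨j, hj⟩ : ∃ j, k + 1 - i = j + 1 := ⟨k - i, by have := Finset.mem_range.1 hi; omega⟩
  rw [hj]
  exact pow_succ j

/-- If a sequence `Q(n) log n + R(n)` with `R(0) = 0` converges, then its limit is zero. -/
lemma eq_zero_of_tendsto {u : ℕ → ℝ} (hu : IsLogPoly u) {L : ℝ} (hL : Tendsto u atTop (𝓝 L)) :
    L = 0 := by
  obtain ⟨Q, R, h0, h⟩ := hu
  have hnat : Tendsto (fun n : ℕ => (n : ℝ)) atTop atTop := tendsto_natCast_atTop_atTop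
  have hlog : Tendsto (fun n : ℕ => Real.log n) atTop atTop := Real.tendsto_log_atTop.comp hnat
  -- A convergent `u` cannot be asymptotic to an unbounded `g`: the ratio would tend to both `0` and
  -- `1`. Below, `g` is whichever of `Q log n` and `R` dominates.
  have hdom : ∀ {f g : ℕ → ℝ}, Tendsto f atTop (𝓝 0) → Tendsto (fun n => |g n|) atTop atTop →
      (∀ᶠ n in atTop, g n ≠ 0 → u n / g n = 1 + f n) → False := by
    intro f g hf hg hfg
    have hg0 : ∀ᶠ n in atTop, g n ≠ 0 :=
      (hg.eventually_gt_atTop 0).mono fun n hn => abs_pos.1 hn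
    have h1 : Tendsto (fun n => u n / g n) atTop (𝓝 0) := by
      rw [tendsto_zero_iff_abs_tendsto_zero]
      simpa [Function.comp_def, abs_div] using hL.abs.div_atTop hg
    have h2 : Tendsto (fun n => u n / g n) atTop (𝓝 (1 + 0)) :=
      (hf.const_add 1).congr' ((hfg.and hg0).mono fun n hn => (hn.1 hn.2).symm)
    have := tendsto_nhds_unique h1 h2
    norm_num at this
  have hev : ∀ᶠ n : ℕ in atTop, 1 ≤ n := eventually_ge_atTop 1
  rcases le_or_gt R.degree Q.degree with hdeg | hdeg
  · by_cases hQ : Q = 0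
    · have hR : R = 0 := by
        rw [hQ, Polynomial.degree_zero, le_bot_iff, Polynomial.degree_eq_bot] at hdeg
        exact hdeg
      refine tendsto_nhds_unique hL (tendsto_const_nhds.congr' ?_)
      filter_upwards [hev] with n hn
      simp [h n hn, hQ, hR]
    · exfalso
      have hQ0 : ∀ᶠ n : ℕ in atTop, Q.eval (n : ℝ) ≠ 0 :=
        hnat.eventually (Polynomial.eventually_atTop_not_isRoot Q hQ)
      have hone : ((fun _ => 1 : ℝ → ℝ)) =O[atTop] fun x => Q.eval x := by
        have := Polynomial.isBigO_atTop_of_degree_le (P := (1 : Polynomial ℝ)) (Q := Q)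
          (by rw [Polynomial.degree_one]; exact Polynomial.zero_le_degree_iff.2 hQ)
        simpa using this
      have hone' : ((fun _ => 1 : ℕ → ℝ)) =O[atTop] fun n : ℕ => Q.eval (n : ℝ) :=
        hone.comp_tendsto hnat
      have hlogO : (fun _ => 1 : ℕ → ℝ) =o[atTop] fun n : ℕ => Real.log n :=
        (Asymptotics.isLittleO_const_left.2 (Or.inr (tendsto_abs_atTop_atTop.comp hlog)))
      have hg : Tendsto (fun n : ℕ => |Q.eval (n : ℝ) * Real.log n|) atTop atTop := by
        have := hone'.mul_isLittleO hlogO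
        simp only [mul_one] at this
        have h3 := (Asymptotics.isLittleO_const_left.1 this).resolve_left one_ne_zero
        exact h3
      refine hdom (f := fun n : ℕ => R.eval (n : ℝ) / (Q.eval (n : ℝ) * Real.log n)) ?_ hg ?_
      · have h1 := ((Polynomial.isBigO_atTop_of_degree_le _ _ hdeg).comp_tendsto hnat).mul_isLittleO
          hlogO
        simp only [mul_one] at h1
        exact h1.tendsto_div_nhds_zero
      · filter_upwards [hev] with n hn hne
        rw [h n hn, add_div, div_self hne]
  · exfalso
    have hR : R ≠ 0 := by
      rintro rfl
      simp at hdeg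
    -- Here `R(0) = 0` is essential: it excludes a nonzero constant `R`, which would be a nonzero
    -- limit.
    have hRpos : 0 < R.degree := by
      by_contra hcon
      have := Polynomial.eq_C_of_degree_le_zero (not_lt.1 hcon)
      rw [this] at h0
      simp only [Polynomial.eval_C] at h0
      rw [h0, map_zero] at this
      exact hR this
    refine hdom (f := fun n : ℕ => (Q.eval (n : ℝ) * Real.log n) / R.eval (n : ℝ))
      (g := fun n : ℕ => R.eval (n : ℝ)) ?_ ((R.abs_tendsto_atTop hRpos).comp hnat) ?_
    -- The gap in degree absorbs the logarithm, as `log x = o(x)`.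
    · have hXQ : (Q * Polynomial.X).degree ≤ R.degree := by
        by_cases hQ : Q = 0
        · simp [hQ]
        · rw [Polynomial.degree_mul, Polynomial.degree_X, Polynomial.degree_eq_natDegree hQ,
            Polynomial.degree_eq_natDegree hR]
          rw [Polynomial.degree_eq_natDegree hQ, Polynomial.degree_eq_natDegree hR] at hdeg
          have : Q.natDegree < R.natDegree := by exact_mod_cast hdeg
          exact_mod_cast this
      have h1 := Polynomial.isBigO_atTop_of_degree_le _ _ hXQ
      have h2 : (fun x : ℝ => Q.eval x * Real.log x) =o[atTop] fun x => (Q * Polynomial.X).eval x := by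
        simp only [Polynomial.eval_mul, Polynomial.eval_X]
        exact (Asymptotics.isBigO_refl _ _).mul_isLittleO Real.isLittleO_log_id_atTop
      exact ((h2.trans_isBigO h1).comp_tendsto hnat).tendsto_div_nhds_zero
    · filter_upwards [hev] with n hn hne
      rw [h n hn, add_div, div_self hne, add_comm]

end IsLogPoly

lemma isLogPoly_glaisherP (k : ℕ) : IsLogPoly fun n => glaisherP n k := by
  unfold glaisherP
  refine IsLogPoly.add (IsLogPoly.add ?_ ?_) (IsLogPoly.const_mul _ (IsLogPoly.sum _ ?_))
  · exact ((IsLogPoly.pow_mul_log k).const_mul (1 / 2)).congr fun n _ => by ring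
  · exact (((IsLogPoly.pow_mul_log (k + 1)).const_mul (1 / ((k : ℝ) + 1))).sub
      ((IsLogPoly.pow_succ k).const_mul (1 / ((k : ℝ) + 1) * (1 / ((k : ℝ) + 1))))).congr
      fun n _ => by ring
  · intro m hm
    have hm' := Finset.mem_Icc.1 hm
    -- For `m = k` the power of `n` is `n^0`; the delta removes what would be a constant term.
    by_cases h : k = m
    · subst h
      exact ((IsLogPoly.pow_mul_log 0).const_mul ((bernoulli (k + 1) : ℝ)
            / (((k + 1).factorial : ℝ) * ((k - k).factorial : ℝ)))).congr fun n _ => by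
        simp
    · obtain ⟨j, hj⟩ : ∃ j, k - m = j + 1 := ⟨k - m - 1, by omega⟩
      rw [hj, if_neg h]
      exact (((IsLogPoly.pow_mul_log (j + 1)).const_mul ((bernoulli (m + 1) : ℝ)
            / (((m + 1).factorial : ℝ) * ((j + 1).factorial : ℝ)))).add
        ((IsLogPoly.pow_succ j).const_mul ((bernoulli (m + 1) : ℝ)
            / (((m + 1).factorial : ℝ) * ((j + 1).factorial : ℝ))
            * ∑ l ∈ Finset.Icc 1 m, 1 / ((k : ℝ) - (l : ℝ) + 1)))).congr fun n _ => by ring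

/-! ### Repeated integrals -/

/-- The definition peels off the outermost integral; inductions that vary `f` need the innermost
one. -/
lemma rightRepeatedIntegral_succ_eq (b : ℝ) (f : ℝ → ℝ) (m : ℕ) :
    rightRepeatedIntegral b f (m + 1)
      = rightRepeatedIntegral b (fun x => ∫ t in x..b, f t) m := by
  induction m with
  | zero => rfl
  | succ m ih =>
    funext x
    change ∫ t in x..b, rightRepeatedIntegral b f (m + 1) t = _
    rw [ih]
    rfl

lemma continuousOn_integral_left {a b : ℝ} {f : ℝ → ℝ} (hf : IntervalIntegrable f volume a b) :
    ContinuousOn (fun x => ∫ t in x..b, f t) (Set.uIcc a b) :=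
  intervalIntegral.continuousOn_primitive_interval_left
    ((intervalIntegrable_iff' (by simp)).1 hf)

lemma intervalIntegrable_rightRepeatedIntegral {a b : ℝ} {f : ℝ → ℝ}
    (hf : IntervalIntegrable f volume a b) (j : ℕ) :
    IntervalIntegrable (rightRepeatedIntegral b f j) volume a b := by
  induction j generalizing f with
  | zero => exact hf
  | succ j ih =>
    rw [rightRepeatedIntegral_succ_eq]
    exact ih (continuousOn_integral_left hf).intervalIntegrable

/-- Cauchy's formula for repeated integration. -/
lemma rightRepeatedIntegral_succ_eq_integral {a b : ℝ} (hab : a ≤ b) {f : ℝ → ℝ}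
    (hc : ContinuousOn f (Set.Ioo a b)) (hf : IntervalIntegrable f volume a b) (m : ℕ) :
    rightRepeatedIntegral b f (m + 1) a
      = 1 / (m.factorial : ℝ) * ∫ t in a..b, (t - a) ^ m * f t := by
  induction m generalizing f with
  | zero => simp [rightRepeatedIntegral]
  | succ m ih =>
    have hderiv : ∀ x ∈ Set.Ioo (min a b) (max a b),
        HasDerivAt (fun x => ∫ t in x..b, f t) (-f x) x := by
      intro x hx
      rw [min_eq_left hab, max_eq_right hab] at hx
      refine intervalIntegral.integral_hasDerivAt_left (hf.mono_set ?_)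
        (hc.stronglyMeasurableAtFilter isOpen_Ioo x hx)
        (hc.continuousAt (Ioo_mem_nhds hx.1 hx.2))
      rw [Set.uIcc_of_le hab, Set.uIcc_of_le hx.2.le]
      exact Set.Icc_subset_Icc hx.1.le le_rfl
    have hcont := continuousOn_integral_left hf
    rw [rightRepeatedIntegral_succ_eq, ih
      (hcont.mono (Set.Ioo_subset_Icc_self.trans Set.Icc_subset_uIcc)) hcont.intervalIntegrable]
    have hv : ∀ x ∈ Set.Ioo (min a b) (max a b),
        HasDerivAt (fun x => (x - a) ^ (m + 1) / ((m : ℝ) + 1)) ((x - a) ^ m) x := by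
      intro x _
      have hm : (m : ℝ) + 1 ≠ 0 := by positivity
      refine ((((hasDerivAt_id x).sub_const a).pow (m + 1)).div_const ((m : ℝ) + 1)).congr_deriv ?_
      simp
      field_simp
    -- Both boundary terms vanish: the power at `a`, the inner integral at `b`.
    have hparts := intervalIntegral.integral_mul_deriv_eq_deriv_mul_of_hasDerivAt hcont
      (v := fun x => (x - a) ^ (m + 1) / ((m : ℝ) + 1)) (by fun_prop) hderiv hv hf.neg
      (by apply Continuous.intervalIntegrable; fun_prop)
    have hcomm : ∫ t in a..b, (t - a) ^ m * (∫ s in t..b, f s)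
        = ∫ t in a..b, (∫ s in t..b, f s) * (t - a) ^ m := by
      simp only [mul_comm]
    rw [hcomm, hparts]
    have hneg : ∫ x in a..b, -f x * ((x - a) ^ (m + 1) / ((m : ℝ) + 1))
        = -(1 / ((m : ℝ) + 1) * ∫ t in a..b, (t - a) ^ (m + 1) * f t) := by
      rw [← intervalIntegral.integral_const_mul, ← intervalIntegral.integral_neg]
      refine intervalIntegral.integral_congr fun x _ => ?_
      ring
    rw [hneg, Nat.factorial_succ]
    have hm : (m : ℝ) + 1 ≠ 0 := by positivity
    have hmf : (m.factorial : ℝ) ≠ 0 := by positivity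
    simp
    field_simp

/-! ### Integrals of the logarithm of the Gamma function -/

lemma logGamma_add_one {t : ℝ} (ht : 0 < t) : logGamma (t + 1) = logGamma t + Real.log t := by
  rw [logGamma, Real.Gamma_add_one ht.ne', Real.log_mul ht.ne' (Real.Gamma_pos_of_pos ht).ne',
    add_comm, logGamma]

lemma continuousOn_logGamma : ContinuousOn logGamma (Set.Ioi 0) := by
  intro t ht
  have ht' : (0 : ℝ) < t := ht
  refine ContinuousAt.continuousWithinAt ?_
  refine ContinuousAt.log (Real.differentiableAt_Gamma fun n => ?_).continuousAt
    (Real.Gamma_pos_of_pos ht').ne'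
  have : (0 : ℝ) ≤ n := by positivity
  linarith

lemma intervalIntegrable_log_add (a b c : ℝ) :
    IntervalIntegrable (fun t : ℝ => Real.log (a + t)) volume b c := by
  have h := (intervalIntegral.intervalIntegrable_log' (a := a + b) (b := a + c)).comp_add_left a
  simpa using h

/-- The only singularity is at `0`, where `log Γ(t) = log Γ(t+1) - log t` reduces it to that of the
logarithm. -/
lemma intervalIntegrable_logGamma : IntervalIntegrable logGamma volume 0 1 := by
  have h1 : IntervalIntegrable (fun t : ℝ => logGamma (t + 1)) volume 0 1 := by
    refine ContinuousOn.intervalIntegrable (continuousOn_logGamma.comp (by fun_prop) ?_)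
    intro t ht
    rw [Set.uIcc_of_le zero_le_one] at ht
    exact Set.mem_Ioi.2 (by linarith [ht.1])
  refine (h1.sub intervalIntegral.intervalIntegrable_log').congr fun t ht => ?_
  rw [Set.uIoc_of_le zero_le_one] at ht
  simp [logGamma_add_one ht.1]

lemma intervalIntegrable_logGamma_nat_add (n : ℕ) :
    IntervalIntegrable (fun t : ℝ => logGamma (n + t)) volume 0 1 := by
  induction n with
  | zero => simpa using intervalIntegrable_logGamma
  | succ n ih =>
    refine (ih.add (intervalIntegrable_log_add n 0 1)).congr fun t ht => ?_
    rw [Set.uIoc_of_le zero_le_one] at ht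
    have hpos : (0 : ℝ) < n + t := by have := ht.1; positivity
    rw [← logGamma_add_one hpos]
    push_cast
    ring_nf

/-- Closed form of the integral of `log (a + t)` against the weight `(p + 1) (1 - t) ^ p`. -/
lemma integral_pow_mul_log_add {a : ℝ} (ha : 0 ≤ a) (p : ℕ) :
    ∫ t in (0 : ℝ)..1, ((p : ℝ) + 1) * (1 - t) ^ p * Real.log (a + t)
      = (a + 1) ^ (p + 1) * (Real.log (a + 1) - (harmonic (p + 1) : ℝ))
        - ∑ i ∈ Finset.range (p + 1), ((p + 1).choose (i + 1) : ℝ)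
            * (a ^ (i + 1) * (Real.log a - (harmonic (i + 1) : ℝ))) := by
  -- This antiderivative comes from repeated integration by parts, since the `i`-fold antiderivative
  -- of `log x` is `x^i/i! (log x - H_i)`.
  have hcont : Continuous fun t : ℝ => ∑ i ∈ Finset.range (p + 1),
      ((p + 1).choose (i + 1) : ℝ) * (1 - t) ^ (p - i)
        * ((a + t) ^ (i + 1) * (Real.log (a + t) - (harmonic (i + 1) : ℝ))) := by
    refine continuous_finsetSum _ fun i _ => Continuous.mul (by fun_prop) ?_
    -- Isolating `x log x` gives continuity at `x = 0`, needed when `a = 0`.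
    have h1 : Continuous fun t : ℝ => (a + t) ^ i * ((a + t) * Real.log (a + t))
        - (a + t) ^ (i + 1) * (harmonic (i + 1) : ℝ) := by
      have := Real.continuous_mul_log.comp (continuous_const.add continuous_id : Continuous
        fun t : ℝ => a + t)
      simp only [Function.comp_def] at this
      fun_prop
    refine h1.congr fun t => ?_
    ring
  have hderiv : ∀ t ∈ Set.Ioo (0 : ℝ) 1, HasDerivAt (fun t : ℝ => ∑ i ∈ Finset.range (p + 1),
      ((p + 1).choose (i + 1) : ℝ) * (1 - t) ^ (p - i)
        * ((a + t) ^ (i + 1) * (Real.log (a + t) - (harmonic (i + 1) : ℝ))))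
      (((p : ℝ) + 1) * (1 - t) ^ p * Real.log (a + t)) t := by
    intro t ht
    have hx : 0 < a + t := by linarith [ht.1]
    -- The derivative telescopes: `T 0` is the integrand and `T (p + 1) = 0`.
    set T : ℕ → ℝ := fun i => ((p + 1).choose i : ℝ) * ((p : ℝ) + 1 - i) * (1 - t) ^ (p - i)
      * ((a + t) ^ i * (Real.log (a + t) - (harmonic i : ℝ))) with hT
    have hadd : HasDerivAt (fun s : ℝ => a + s) 1 t := (hasDerivAt_id t).const_add a
    have hsub : HasDerivAt (fun s : ℝ => 1 - s) (-1) t := (hasDerivAt_id t).const_sub 1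
    have hterm : ∀ i ∈ Finset.range (p + 1), HasDerivAt (fun t : ℝ =>
        ((p + 1).choose (i + 1) : ℝ) * (1 - t) ^ (p - i)
        * ((a + t) ^ (i + 1) * (Real.log (a + t) - (harmonic (i + 1) : ℝ))))
        (T i - T (i + 1)) t := by
      intro i hi
      obtain ⟨q, rfl⟩ : ∃ q, p = i + q := ⟨p - i, by have := Finset.mem_range.1 hi; omega⟩
      have h := ((hsub.pow (i + q - i)).const_mul ((i + q + 1).choose (i + 1) : ℝ)).mul
        ((hadd.pow (i + 1)).mul ((hadd.log hx.ne').sub_const (harmonic (i + 1) : ℝ)))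
      refine h.congr_deriv ?_
      have e1 : i + q - i = q := by omega
      have e2 : i + q - (i + 1) = q - 1 := by omega
      have hch : ((i + q + 1).choose i : ℝ) * ((q : ℝ) + 1)
          = ((i + q + 1).choose (i + 1) : ℝ) * ((i : ℝ) + 1) := by
        have := Nat.choose_succ_right_eq (i + q + 1) i
        have e3 : i + q + 1 - i = q + 1 := by omega
        rw [e3] at this
        exact_mod_cast this.symm
      have e4 : (((i + q : ℕ) : ℝ) + 1 - i) = q + 1 := by push_cast; ring
      have e5 : (((i + q : ℕ) : ℝ) + 1 - ((i + 1 : ℕ) : ℝ)) = q := by push_cast; ring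
      have hhar : (harmonic (i + 1) : ℝ) = (harmonic i : ℝ) + 1 / ((i : ℝ) + 1) := by
        rw [harmonic_succ]; push_cast; ring
      have hi1 : (i : ℝ) + 1 ≠ 0 := by positivity
      simp only [hT, Pi.pow_apply, Pi.mul_apply, e4, e5, e1, e2, hch, hhar]
      have hx' := hx.ne'
      push_cast
      field_simp
      ring
    have hsum := HasDerivAt.fun_sum hterm
    refine hsum.congr_deriv ?_
    rw [Finset.sum_range_sub']
    simp [hT]
  have hint : IntervalIntegrable
      (fun t : ℝ => ((p : ℝ) + 1) * (1 - t) ^ p * Real.log (a + t)) volume 0 1 :=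
    (intervalIntegrable_log_add a 0 1).continuousOn_mul (by fun_prop)
  rw [intervalIntegral.integral_eq_sub_of_hasDerivAt_of_le zero_le_one hcont.continuousOn hderiv
    hint]
  congr 1
  · rw [Finset.sum_range_succ, Finset.sum_eq_zero]
    · simp
    · intro i hi
      have hi' := Finset.mem_range.1 hi
      simp [show p - i ≠ 0 by omega]
  · simp

lemma integral_pow_weight (p : ℕ) :
    ∫ t in (0 : ℝ)..1, ((p : ℝ) + 1) * (1 - t) ^ p = 1 := by
  have h := intervalIntegral.integral_comp_sub_left (a := 0) (b := 1)
    (fun t : ℝ => ((p : ℝ) + 1) * t ^ p) 1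
  have hp : (p : ℝ) + 1 ≠ 0 := by positivity
  rw [h, intervalIntegral.integral_const_mul, integral_pow]
  simp
  field_simp

lemma integral_pow_weight_mul_id (p : ℕ) :
    ∫ t in (0 : ℝ)..1, ((p : ℝ) + 1) * (1 - t) ^ p * t = 1 / ((p : ℝ) + 2) := by
  have h := intervalIntegral.integral_comp_sub_left (a := 0) (b := 1)
    (fun t : ℝ => ((p : ℝ) + 1) * t ^ p * (1 - t)) 1
  have hp : (p : ℝ) + 1 ≠ 0 := by positivity
  have hp2 : (p : ℝ) + 2 ≠ 0 := by positivity
  have hp3 : (p : ℝ) + 1 + 1 ≠ 0 := by positivity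
  simp only [sub_sub_cancel, sub_self, sub_zero] at h
  rw [h]
  have e : ∀ t : ℝ, ((p : ℝ) + 1) * t ^ p * (1 - t)
      = ((p : ℝ) + 1) * t ^ p - ((p : ℝ) + 1) * t ^ (p + 1) := fun t => by ring
  simp only [e]
  rw [intervalIntegral.integral_sub (by apply Continuous.intervalIntegrable; fun_prop)
    (by apply Continuous.intervalIntegrable; fun_prop), intervalIntegral.integral_const_mul,
    intervalIntegral.integral_const_mul, integral_pow, integral_pow]
  simp
  field_simp
  ring

/-! ### The weighted integral of `log Γ` in terms of the Glaisher constants -/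

/-- The integral of `log Γ (n + t)` against the weight `(p + 1) (1 - t) ^ p`. -/
noncomputable def weightedLogGamma (p n : ℕ) : ℝ :=
  ∫ t in (0 : ℝ)..1, ((p : ℝ) + 1) * (1 - t) ^ p * logGamma (n + t)

lemma weightedLogGamma_succ (p n : ℕ) :
    weightedLogGamma p (n + 1) = weightedLogGamma p n
      + ∫ t in (0 : ℝ)..1, ((p : ℝ) + 1) * (1 - t) ^ p * Real.log (n + t) := by
  rw [weightedLogGamma, weightedLogGamma, ← intervalIntegral.integral_add
    ((intervalIntegrable_logGamma_nat_add n).continuousOn_mul (by fun_prop))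
    ((intervalIntegrable_log_add n 0 1).continuousOn_mul (by fun_prop))]
  refine intervalIntegral.integral_congr_ae (ae_of_all _ fun t ht => ?_)
  rw [Set.uIoc_of_le zero_le_one] at ht
  have hpos : (0 : ℝ) < n + t := by have := ht.1; positivity
  rw [← mul_add, ← logGamma_add_one hpos]
  push_cast
  ring_nf

lemma weightedLogGamma_zero_eq (p n : ℕ) :
    weightedLogGamma p 0 = weightedLogGamma p n - ∑ j ∈ Finset.range n,
      ∫ t in (0 : ℝ)..1, ((p : ℝ) + 1) * (1 - t) ^ p * Real.log (j + t) := by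
  induction n with
  | zero => simp
  | succ n ih => rw [ih, Finset.sum_range_succ, weightedLogGamma_succ]; ring

/-- In the closed form of each integral, the term `i = p` telescopes against the leading term in `j
+ 1`; only `i < p` survives in the sum. -/
lemma sum_integral_pow_mul_log (p n : ℕ) :
    ∑ j ∈ Finset.range n,
        ∫ t in (0 : ℝ)..1, ((p : ℝ) + 1) * (1 - t) ^ p * Real.log (j + t)
      = (n : ℝ) ^ (p + 1) * (Real.log n - (harmonic (p + 1) : ℝ))
        - ∑ i ∈ Finset.range p, ((p + 1).choose (i + 1) : ℝ)
          * (∑ j ∈ Finset.range n, (j : ℝ) ^ (i + 1) * Real.log j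
            - (harmonic (i + 1) : ℝ) * ∑ j ∈ Finset.range n, (j : ℝ) ^ (i + 1)) := by
  induction n with
  | zero => simp
  | succ n ih =>
    rw [Finset.sum_range_succ, ih, integral_pow_mul_log_add (Nat.cast_nonneg n),
      Finset.sum_range_succ _ p]
    have hsplit : ∀ i, ((p + 1).choose (i + 1) : ℝ)
          * (∑ j ∈ Finset.range (n + 1), (j : ℝ) ^ (i + 1) * Real.log j
            - (harmonic (i + 1) : ℝ) * ∑ j ∈ Finset.range (n + 1), (j : ℝ) ^ (i + 1))
        = ((p + 1).choose (i + 1) : ℝ)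
          * (∑ j ∈ Finset.range n, (j : ℝ) ^ (i + 1) * Real.log j
            - (harmonic (i + 1) : ℝ) * ∑ j ∈ Finset.range n, (j : ℝ) ^ (i + 1))
          + ((p + 1).choose (i + 1) : ℝ)
            * ((n : ℝ) ^ (i + 1) * (Real.log n - (harmonic (i + 1) : ℝ))) := by
      intro i
      rw [Finset.sum_range_succ, Finset.sum_range_succ]
      ring
    simp only [hsplit, Finset.sum_add_distrib, Nat.choose_self]
    push_cast
    ring

/-- Convexity of `log Γ` compares slopes on neighbouring intervals, as in the Bohr-Mollerup theorem.
The bounds are affine in `t`, so they integrate exactly against the weight, and they differ by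
`o(1)`. -/
lemma logGamma_nat_add_bounds {n : ℕ} (hn : 2 ≤ n) {t : ℝ} (ht : t ∈ Set.Ioc (0 : ℝ) 1) :
    logGamma n + t * Real.log ((n : ℝ) - 1) ≤ logGamma (n + t) ∧
      logGamma (n + t) ≤ logGamma n + t * Real.log n :=
  ⟨Real.BohrMollerup.f_add_nat_ge Real.convexOn_log_Gamma logGamma_add_one hn ht.1,
    Real.BohrMollerup.f_add_nat_le Real.convexOn_log_Gamma logGamma_add_one
      (by omega) ht.1 ht.2⟩

lemma integral_pow_weight_mul_affine (p : ℕ) (c d : ℝ) :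
    ∫ t in (0 : ℝ)..1, ((p : ℝ) + 1) * (1 - t) ^ p * (c + t * d)
      = c + d / ((p : ℝ) + 2) := by
  have e : ∀ t : ℝ, ((p : ℝ) + 1) * (1 - t) ^ p * (c + t * d)
      = c * (((p : ℝ) + 1) * (1 - t) ^ p) + d * (((p : ℝ) + 1) * (1 - t) ^ p * t) :=
    fun t => by ring
  simp only [e]
  rw [intervalIntegral.integral_add (by apply Continuous.intervalIntegrable; fun_prop)
    (by apply Continuous.intervalIntegrable; fun_prop), intervalIntegral.integral_const_mul c,
    intervalIntegral.integral_const_mul d, integral_pow_weight, integral_pow_weight_mul_id]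
  ring

lemma weightedLogGamma_bounds (p : ℕ) {n : ℕ} (hn : 2 ≤ n) :
    logGamma n + Real.log ((n : ℝ) - 1) / ((p : ℝ) + 2) ≤ weightedLogGamma p n ∧
      weightedLogGamma p n ≤ logGamma n + Real.log n / ((p : ℝ) + 2) := by
  have hi := (intervalIntegrable_logGamma_nat_add n).continuousOn_mul
    (g := fun t => ((p : ℝ) + 1) * (1 - t) ^ p) (by fun_prop)
  have hw : ∀ t ∈ Set.Ioo (0 : ℝ) 1, 0 ≤ ((p : ℝ) + 1) * (1 - t) ^ p := fun t ht => by
    have : 0 ≤ 1 - t := by linarith [ht.2]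
    positivity
  rw [← integral_pow_weight_mul_affine p (logGamma n), ← integral_pow_weight_mul_affine p,
    weightedLogGamma]
  constructor
  · exact intervalIntegral.integral_mono_on_of_le_Ioo zero_le_one
      (by apply Continuous.intervalIntegrable; fun_prop) hi fun t ht =>
        mul_le_mul_of_nonneg_left (logGamma_nat_add_bounds hn ⟨ht.1, ht.2.le⟩).1 (hw t ht)
  · exact intervalIntegral.integral_mono_on_of_le_Ioo zero_le_one hi
      (by apply Continuous.intervalIntegrable; fun_prop) fun t ht =>
        mul_le_mul_of_nonneg_left (logGamma_nat_add_bounds hn ⟨ht.1, ht.2.le⟩).2 (hw t ht)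

lemma tendsto_weightedLogGamma_sub (p : ℕ) :
    Tendsto (fun n : ℕ => weightedLogGamma p n - logGamma n - Real.log n / ((p : ℝ) + 2))
      atTop (𝓝 0) := by
  have hlow : Tendsto (fun n : ℕ => Real.log (1 - (n : ℝ)⁻¹) / ((p : ℝ) + 2)) atTop (𝓝 0) := by
    have h1 : Tendsto (fun n : ℕ => 1 - (n : ℝ)⁻¹) atTop (𝓝 (1 - 0)) :=
      tendsto_inv_atTop_nhds_zero_nat.const_sub 1
    simpa using (h1.log (by norm_num)).div_const ((p : ℝ) + 2)
  refine tendsto_of_tendsto_of_tendsto_of_le_of_le' hlow tendsto_const_nhds ?_ ?_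
  · filter_upwards [eventually_ge_atTop 2] with n hn
    have h := (weightedLogGamma_bounds p hn).1
    have hn' : (2 : ℝ) ≤ n := by exact_mod_cast hn
    have hn0 : (n : ℝ) ≠ 0 := by positivity
    have e : 1 - (n : ℝ)⁻¹ = ((n : ℝ) - 1) / n := by field_simp
    rw [e, Real.log_div (by linarith) hn0, sub_div]
    linarith
  · filter_upwards [eventually_ge_atTop 2] with n hn
    linarith [(weightedLogGamma_bounds p hn).2]

lemma sum_range_pow_mul_log (k n : ℕ) :
    ∑ j ∈ Finset.range n, (j : ℝ) ^ k * Real.log j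
      = glaisherSeq k n + glaisherP n k - (n : ℝ) ^ k * Real.log n := by
  have h : ∑ j ∈ Finset.range (n + 1), (j : ℝ) ^ k * Real.log j
      = ∑ j ∈ Finset.Icc 1 n, (j : ℝ) ^ k * Real.log j := by
    rw [Finset.range_eq_Ico, Finset.sum_eq_sum_Ico_succ_bot (by omega)]
    simp
    rfl
  rw [Finset.sum_range_succ] at h
  rw [glaisherSeq]
  linarith

lemma logGamma_nat {n : ℕ} (hn : 1 ≤ n) :
    logGamma n = ∑ j ∈ Finset.range n, (j : ℝ) ^ 0 * Real.log j := by
  induction n, hn using Nat.le_induction with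
  | base => simp [logGamma]
  | succ n hn ih =>
    rw [Finset.sum_range_succ, ← ih]
    push_cast
    rw [logGamma_add_one (by positivity)]
    simp

/-- The sequence `u` below tends to the difference of the two sides, and the shift identity shows
that it has the form `Q(n) log n + R(n)` with `R(0) = 0`. -/
lemma weightedLogGamma_zero_eq_sum (p : ℕ) :
    weightedLogGamma p 0
      = ∑ k ∈ Finset.range (p + 1), ((p + 1).choose k : ℝ) * Real.log (glaisherD k) := by
  set err : ℕ → ℝ := fun n =>
    weightedLogGamma p n - logGamma n - Real.log n / ((p : ℝ) + 2) with herr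
  set u : ℕ → ℝ := fun n => weightedLogGamma p 0 - err n
    - ∑ k ∈ Finset.range (p + 1), ((p + 1).choose k : ℝ) * glaisherSeq k n with hu
  have hlim : Tendsto u atTop (𝓝 (weightedLogGamma p 0 - 0
      - ∑ k ∈ Finset.range (p + 1), ((p + 1).choose k : ℝ) * Real.log (glaisherD k))) :=
    ((tendsto_weightedLogGamma_sub p).const_sub _).sub
      (tendsto_finsetSum _ fun k _ => (tendsto_glaisherSeq k).const_mul _)
  have hpoly : IsLogPoly u := by
    have h : IsLogPoly fun n : ℕ => (1 / ((p : ℝ) + 2)) * ((n : ℝ) ^ 0 * Real.log n)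
        - ((n : ℝ) ^ (p + 1) * Real.log n - (harmonic (p + 1) : ℝ) * (n : ℝ) ^ (p + 1))
        + ∑ k ∈ Finset.range (p + 1), ((p + 1).choose k : ℝ)
          * (glaisherP n k - (n : ℝ) ^ k * Real.log n
            - (harmonic k : ℝ) * ∑ j ∈ Finset.range n, (j : ℝ) ^ k) :=
      (((IsLogPoly.pow_mul_log 0).const_mul _).sub ((IsLogPoly.pow_mul_log (p + 1)).sub
        ((IsLogPoly.pow_succ p).const_mul _))).add
        (IsLogPoly.sum _ fun k _ => (((isLogPoly_glaisherP k).sub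
          (IsLogPoly.pow_mul_log k)).sub ((IsLogPoly.sum_range_pow k).const_mul _)).const_mul _)
    refine h.congr fun n hn => ?_
    have hsum : ∑ k ∈ Finset.range (p + 1), ((p + 1).choose k : ℝ)
          * (glaisherP n k - (n : ℝ) ^ k * Real.log n
            - (harmonic k : ℝ) * ∑ j ∈ Finset.range n, (j : ℝ) ^ k)
        = ∑ k ∈ Finset.range (p + 1), ((p + 1).choose k : ℝ)
          * (∑ j ∈ Finset.range n, (j : ℝ) ^ k * Real.log j
            - (harmonic k : ℝ) * ∑ j ∈ Finset.range n, (j : ℝ) ^ k)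
          - ∑ k ∈ Finset.range (p + 1), ((p + 1).choose k : ℝ) * glaisherSeq k n := by
      rw [← Finset.sum_sub_distrib]
      refine Finset.sum_congr rfl fun k _ => ?_
      rw [sum_range_pow_mul_log]
      ring
    simp only [hu, herr]
    -- The `k = 0` term is exactly `log Γ(n)`, because `H_0 = 0`.
    rw [hsum, Finset.sum_range_succ' (fun k => ((p + 1).choose k : ℝ)
          * (∑ j ∈ Finset.range n, (j : ℝ) ^ k * Real.log j
            - (harmonic k : ℝ) * ∑ j ∈ Finset.range n, (j : ℝ) ^ k)),
      ← logGamma_nat hn, weightedLogGamma_zero_eq p n, sum_integral_pow_mul_log]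
    simp
    ring
  have := hpoly.eq_zero_of_tendsto hlim
  linarith

/-! ### The reflection formula and the main theorem -/

lemma log_sin_pi_mul {t : ℝ} (ht : t ∈ Set.Ioo (0 : ℝ) 1) :
    Real.log (Real.sin (Real.pi * t)) = Real.log Real.pi - logGamma t - logGamma (1 - t) := by
  have h1 := Real.Gamma_pos_of_pos ht.1
  have h2 : 0 < Real.Gamma (1 - t) := Real.Gamma_pos_of_pos (by linarith [ht.2])
  have hs : 0 < Real.sin (Real.pi * t) :=
    Real.sin_pos_of_pos_of_lt_pi (mul_pos Real.pi_pos ht.1)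
      (by nlinarith [Real.pi_pos, ht.2])
  have h := congrArg Real.log (Real.Gamma_mul_Gamma_one_sub t)
  rw [Real.log_mul h1.ne' h2.ne', Real.log_div Real.pi_ne_zero hs.ne'] at h
  simp only [logGamma]
  linarith

lemma intervalIntegrable_logGamma_one_sub :
    IntervalIntegrable (fun t : ℝ => logGamma (1 - t)) volume 0 1 := by
  simpa using (intervalIntegrable_logGamma.comp_sub_left 1).symm

/-- The endpoint `1` must be discarded: the logarithmic reflection formula fails there with the
default values of `log` and `Γ` at `0`. -/
lemma ae_mem_Ioo_of_mem_uIoc :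
    ∀ᵐ t : ℝ, t ∈ Set.uIoc (0 : ℝ) 1 → t ∈ Set.Ioo (0 : ℝ) 1 := by
  filter_upwards [Measure.ae_ne volume (1 : ℝ)] with t ht1 ht
  rw [Set.uIoc_of_le zero_le_one] at ht
  exact ⟨ht.1, lt_of_le_of_ne ht.2 ht1⟩

lemma intervalIntegrable_log_sin_pi_mul :
    IntervalIntegrable (fun t : ℝ => Real.log (Real.sin (Real.pi * t))) volume 0 1 := by
  refine (((intervalIntegrable_const (c := Real.log Real.pi)).sub intervalIntegrable_logGamma).sub
    intervalIntegrable_logGamma_one_sub).congr_ae ?_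
  rw [EventuallyEq, ae_restrict_iff' measurableSet_uIoc]
  filter_upwards [ae_mem_Ioo_of_mem_uIoc] with t ht htm
  exact (log_sin_pi_mul (ht htm)).symm

/-- Reflection splits `log sin` into three terms; `t ↦ 1 - t` turns the one with `log Γ(1 - t)` into
`W(0)`. -/
lemma integral_pow_mul_log_sin (p : ℕ) :
    ∫ t in (0 : ℝ)..1, ((p : ℝ) + 1) * t ^ p * Real.log (Real.sin (Real.pi * t))
      = Real.log Real.pi - ((p : ℝ) + 1) * (∫ t in (0 : ℝ)..1, t ^ p * logGamma t)
        - weightedLogGamma p 0 := by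
  have hJ : weightedLogGamma p 0
      = ∫ t in (0 : ℝ)..1, ((p : ℝ) + 1) * t ^ p * logGamma (1 - t) := by
    have h := intervalIntegral.integral_comp_sub_left (a := 0) (b := 1)
      (fun t : ℝ => ((p : ℝ) + 1) * t ^ p * logGamma (1 - t)) 1
    simpa [weightedLogGamma] using h
  have hconst : ∫ t in (0 : ℝ)..1, ((p : ℝ) + 1) * t ^ p * Real.log Real.pi
      = Real.log Real.pi := by
    have hp : (p : ℝ) + 1 ≠ 0 := by positivity
    rw [intervalIntegral.integral_mul_const, intervalIntegral.integral_const_mul, integral_pow]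
    simp
    field_simp
  rw [hJ, ← intervalIntegral.integral_const_mul]
  nth_rewrite 1 [← hconst]
  rw [← intervalIntegral.integral_sub
      (by apply Continuous.intervalIntegrable; fun_prop)
      ((intervalIntegrable_logGamma.continuousOn_mul (by fun_prop)).const_mul _),
    ← intervalIntegral.integral_sub ((by
        apply Continuous.intervalIntegrable; fun_prop : IntervalIntegrable _ _ _ _).sub
      ((intervalIntegrable_logGamma.continuousOn_mul (by fun_prop)).const_mul _))
      (intervalIntegrable_logGamma_one_sub.continuousOn_mul (by fun_prop))]
  refine intervalIntegral.integral_congr_ae ?_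
  filter_upwards [ae_mem_Ioo_of_mem_uIoc] with t ht htm
  rw [log_sin_pi_mul (ht htm)]
  ring

theorem mainTheorem6 (m : ℕ) (hm : 1 ≤ m) :
    -- the limits that define the constants `D_k` exist
    (∀ k < m, Tendsto (glaisherSeq k) atTop (𝓝 (Real.log (glaisherD k)))) ∧
    -- all the integrals that occur converge absolutely
    IntervalIntegrable (fun t : ℝ => (t - 0) ^ ((m : ℝ) - 1) * logGamma t) volume 0 1 ∧
    (∀ j < m, IntervalIntegrable (rightRepeatedIntegral 1 logGamma j) volume 0 1) ∧
    IntervalIntegrable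
      (fun t : ℝ => (m : ℝ) * t ^ (m - 1) * Real.log (Real.sin (Real.pi * t))) volume 0 1 ∧
    -- the two equalities
    rightRiemannLiouville 1 (m : ℝ) logGamma 0 = rightRepeatedIntegral 1 logGamma m 0 ∧
    rightRepeatedIntegral 1 logGamma m 0 =
      1 / (m.factorial : ℝ) *
        (-(∑ k ∈ Finset.range m, (m.choose k : ℝ) * Real.log (glaisherD k))
          + Real.log Real.pi
          - ∫ t in (0 : ℝ)..1,
              (m : ℝ) * t ^ (m - 1) * Real.log (Real.sin (Real.pi * t))) := by
  obtain ⟨p, rfl⟩ : ∃ p, m = p + 1 := ⟨m - 1, by omega⟩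
  have hrpow : ∀ t : ℝ, (t - 0) ^ (((p + 1 : ℕ) : ℝ) - 1) = t ^ p := by
    intro t
    rw [sub_zero, ← Real.rpow_natCast]
    push_cast
    ring_nf
  have hCauchy := rightRepeatedIntegral_succ_eq_integral zero_le_one
    (continuousOn_logGamma.mono fun t ht => ht.1) intervalIntegrable_logGamma p
  simp only [sub_zero] at hCauchy
  refine ⟨fun k _ => tendsto_glaisherSeq k, ?_,
    fun j _ => intervalIntegrable_rightRepeatedIntegral intervalIntegrable_logGamma j,
    intervalIntegrable_log_sin_pi_mul.continuousOn_mul (by fun_prop), ?_, ?_⟩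
  · simp only [hrpow]
    exact intervalIntegrable_logGamma.continuousOn_mul (by fun_prop)
  · rw [rightRiemannLiouville, hCauchy]
    simp only [hrpow]
    push_cast
    rw [Real.Gamma_nat_eq_factorial]
  · have h := integral_pow_mul_log_sin p
    rw [weightedLogGamma_zero_eq_sum] at h
    rw [hCauchy]
    simp only [Nat.add_sub_cancel]
    push_cast
    rw [h, Nat.factorial_succ]
    have hp : (p : ℝ) + 1 ≠ 0 := by positivity
    have hf : (p.factorial : ℝ) ≠ 0 := by positivity
    push_cast
    field_simp
    ring
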